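/- Let $S,A$ be finite state and action spaces, $\mathcal Q\subseteq\mathcal P(A)$ a set of admissible randomized decisions, and $\mathcal P\subseteq\{S\times A\to\mathcal P(S)\}$ a set of transition kernels. A policy $\pi\in\Pi_{\mathrm H}(\mathcal Q)$ is a sequence of maps $\pi_t$ from histories $h_t=(s_0,a_0,\dots,a_{t-1},s_t)$ to $\mathcal Q$; $P_\mu^{\pi,p}$ denotes the law on $(S\times A)^{\mathbb Z_{\ge0}}$ of the process $(X_t,A_t)_{t\ge0}$ with initial law $\mu$, policy $\pi$ and kernel $p$. For $r:S\times A\to[0,1]$ let $$R_{r,p}(T)=\sum_{t=0}^{T-1}\bigl[\alpha_p(X_0)-r(X_t,A_t)\bigr],$$ where the optimal gain $\alpha_p$ is the $\alpha$-part of a solution $(\alpha,v)$ of $\alpha(s)=\max_a\sum_{s'}p(s'|s,a)\alpha(s')$ and $v(s)=\max_a\{r(s,a)-\alpha(s)+\sum_{s'}p(s'|s,a)v(s')\}$ (the pointwise smallest one, if it is not unique). For a set $\mathcal R$ of reward functions $S\times A\to[0,1]$, let $\Pi_{\mathrm{RL}}(\mathcal Q,\mathcal P;\mathcal R)$ be the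 set of $\pi\in\Pi_{\mathrm H}(\mathcal Q)$ with $$\limsup_{T\to\infty}\tfrac1T E_\mu^{\pi,p}R_{r,p}(T)=0\quad\text{for all }p\in\mathcal P,\ \mu\in\mathcal P(S),\ r\in\mathcal R,$$ and let $\Pi_{\mathrm{RL}}(\mathcal Q,\mathcal P)$ be this set for the class $\mathcal R$ of all $r:S\times A\to[0,1]$. A kernel $p$ is weakly communicating if there is a nonempty $C\subseteq S$ such that for all $s,s'\in C$ there are $\Delta:S\to\mathcal Q$ and $N\ge1$ with $p_\Delta^N(s'|s)>0$, where $p_\Delta(s'|s)=\sum_a p(s'|s,a)\Delta(a|s)$, and every $s\notin C$ is transient under $p_\Delta$ for every $\Delta:S\to\mathcal Q$. Suppose that every $p\in\mathcal P$ is weakly communicating, and that $\mathcal Q$ contains all point masses $\delta_a$, $a\in A$ (this is not needed if $\mathcal R$ is the class of all reward functions). Suppose further that there are policies $\pi(T)\in\Pi_{\mathrm H}(\mathcal Q)$, $T\ge0$, and parameters $\eta\in(0,1)$, $\beta>0$ and an integer $K\ge1$ such that for all $p\in\mathcal P$, $r\in\mathcal R$ and $\mu\in\mathcal P(S)$ there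 is a constant $f_{\mu,r,p}\ge0$ with $$P_\mu^{\pi(T),p}\bigl(R_{r,p}(T)\le f_{\mu,r,p}\,T^\eta\bigr)\ge1-\frac1{T^\beta}\qquad\text{for all integers }T\ge K.$$ Then $\Pi_{\mathrm{RL}}(\mathcal Q,\mathcal P;\mathcal R)\ne\varnothing$. More precisely, it contains the doubling-epoch restart policy that follows an arbitrary $\pi_0\in\Pi_{\mathrm H}(\mathcal Q)$ at times $t<K$ and, for each $n\ge0$, at times $2^nK\le t<2^{n+1}K$ discards all data collected before time $2^nK$ and runs a fresh instance of $\pi(2^nK)$. In particular, if the assumption holds for all reward functions, then $\Pi_{\mathrm{RL}}(\mathcal Q,\mathcal P)\ne\varnothing$. -/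

import Mathlib

open MeasureTheory ProbabilityTheory Filter Topology

noncomputable section

/-- A controlled transition kernel `p(s' | s, a)`. -/
abbrev TransKernel (S A : Type*) := S → A → PMF S

/-- A reward function `r : S × A → [0, 1]`. -/
abbrev Reward (S A : Type*) := S → A → unitInterval

/-- Histories `h_t = (s_0, a_0, …, s_{t-1}, a_{t-1}, s_t)`: the first `t` state-action pairs,
together with the current state. -/
abbrev Hist (S A : Type*) (t : ℕ) := (Fin t → S × A) × S

/-- A (randomized, history-dependent) controller policy `π = (π_0, π_1, …)`. -/
abbrev Policy (S A : Type*) := ∀ t : ℕ, Hist S A t → PMF A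

/-- The history `H_t(ω)` of a sample path `ω = (s_0, a_0, s_1, a_1, …)`. -/
def histOf {S A : Type*} (ω : ℕ → S × A) (t : ℕ) : Hist S A t :=
  (fun i => ω i, (ω t).1)

/-- `Π_H(Q)`: the history-dependent policies all of whose decisions lie in `Q`. -/
def PiH {S A : Type*} (Q : Set (PMF A)) : Set (Policy S A) :=
  {π | ∀ t h, π t h ∈ Q}

section PathMeasure

variable {S A : Type*}

/-- The law of `(X_0, A_0)`: `μ(s) π_0(a | s)`. -/
def initPMF (μ : PMF S) (π : Policy S A) : PMF (S × A) :=
  μ.bind fun s => (π 0 (Fin.elim0, s)).map (Prod.mk s)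

/-- The conditional law of `(X_{n+1}, A_{n+1})` given `(X_0, A_0, …, X_n, A_n) = x`:
`p(s' | x_n) π_{n+1}(a' | x, s')`. -/
def stepPMF (p : TransKernel S A) (π : Policy S A) (n : ℕ) (x : Finset.Iic n → S × A) :
    PMF (S × A) :=
  (p (x ⟨n, by simp⟩).1 (x ⟨n, by simp⟩).2).bind fun s' =>
    (π (n + 1) (fun i => x ⟨i, Finset.mem_Iic.2 (Nat.lt_succ_iff.1 i.2)⟩, s')).map (Prod.mk s')

variable [Fintype S] [Fintype A] [MeasurableSpace S] [MeasurableSpace A]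
  [DiscreteMeasurableSpace S] [DiscreteMeasurableSpace A]

/-- `stepPMF` as a Markov kernel. -/
def stepKernel (p : TransKernel S A) (π : Policy S A) (n : ℕ) :
    Kernel (Finset.Iic n → S × A) (S × A) :=
  Kernel.ofFunOfCountable fun x => (stepPMF p π n x).toMeasure

instance (p : TransKernel S A) (π : Policy S A) (n : ℕ) : IsMarkovKernel (stepKernel p π n) :=
  ⟨fun x => by
    change IsProbabilityMeasure (stepPMF p π n x).toMeasure
    infer_instance⟩

/-- The canonical measure `P_μ^{π,p}` on the path space `(S × A)^ℕ` with the cylinder σ-field. -/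
def pathMeasure (μ : PMF S) (π : Policy S A) (p : TransKernel S A) : Measure (ℕ → S × A) :=
  Kernel.trajMeasure (X := fun _ => S × A) (initPMF μ π).toMeasure (stepKernel p π)

instance (μ : PMF S) (π : Policy S A) (p : TransKernel S A) :
    IsProbabilityMeasure (pathMeasure μ π p) := by
  unfold pathMeasure
  infer_instance

end PathMeasure

section PathMeasureCharacterization
variable {S A : Type*}

theorem initPMF_map_fst (μ : PMF S) (π : Policy S A) : (initPMF μ π).map Prod.fst = μ := by
  simp only [initPMF, PMF.map_bind, PMF.map_comp]
  have : ∀ s : S, (Prod.fst ∘ Prod.mk s : A → S) = Function.const _ s := fun s => rfl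
  simp [this, PMF.map_const]

theorem stepPMF_map_fst (p : TransKernel S A) (π : Policy S A) (n : ℕ)
    (x : Finset.Iic n → S × A) :
    (stepPMF p π n x).map Prod.fst = p (x ⟨n, by simp⟩).1 (x ⟨n, by simp⟩).2 := by
  simp only [stepPMF, PMF.map_bind, PMF.map_comp]
  have : ∀ s : S, (Prod.fst ∘ Prod.mk s : A → S) = Function.const _ s := fun s => rfl
  simp [this, PMF.map_const]

theorem bind_map_mk_apply (ν : PMF S) (q : S → PMF A) (y : S × A) :
    (ν.bind fun s => (q s).map (Prod.mk s)) y = ν y.1 * q y.1 y.2 := by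
  classical
  obtain ⟨s, a⟩ := y
  simp only [PMF.bind_apply, PMF.map_apply]
  rw [tsum_eq_single s]
  · congr 1
    rw [tsum_eq_single a] <;> simp +contextual [eq_comm]
  · intro b hb
    simp [Ne.symm hb]

variable [Fintype S] [Fintype A] [MeasurableSpace S] [MeasurableSpace A]
  [DiscreteMeasurableSpace S] [DiscreteMeasurableSpace A]

theorem pathMeasure_map_zero (μ : PMF S) (π : Policy S A) (p : TransKernel S A) :
    (pathMeasure μ π p).map (fun ω => ω 0) = (initPMF μ π).toMeasure := by
  unfold pathMeasure Kernel.trajMeasure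
  rw [Measure.map_comp _ _ (by fun_prop)]
  have h : (fun ω : ℕ → S × A => ω 0) =
      (fun y : (Finset.Iic 0 → S × A) => y ⟨0, by simp⟩) ∘ Preorder.frestrictLe 0 := rfl
  have h2 : (Kernel.traj (X := fun _ => S × A) (stepKernel p π) 0).map (fun ω => ω 0)
      = Kernel.deterministic (fun y : (Finset.Iic 0 → S × A) => y ⟨0, by simp⟩) (by fun_prop) := by
    rw [h, Kernel.map_comp_right _ (Preorder.measurable_frestrictLe 0) (by fun_prop),
      Kernel.traj_map_frestrictLe, Kernel.partialTraj_self]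
    exact Kernel.deterministic_map (by fun_prop) (by fun_prop)
  rw [h2, Measure.deterministic_comp_eq_map, Measure.map_map (by fun_prop) (by fun_prop)]
  exact Measure.map_id

theorem pathMeasure_step (μ : PMF S) (π : Policy S A) (p : TransKernel S A) (n : ℕ)
    (x : Finset.Iic n → S × A) (B : Set (S × A)) :
    pathMeasure μ π p {ω | Preorder.frestrictLe (π := fun _ => S × A) n ω = x ∧ ω (n + 1) ∈ B} =
      (stepPMF p π n x).toMeasure B *
      pathMeasure μ π p {ω | Preorder.frestrictLe (π := fun _ => S × A) n ω = x} := by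
  have h := Kernel.map_frestrictLe_trajMeasure_compProd_eq_map_trajMeasure (X := fun _ => S × A)
    (μ₀ := (initPMF μ π).toMeasure) (κ := stepKernel p π) (a := n)
  have h' := congrArg (fun m => m ({x} ×ˢ B)) h
  have m1 : MeasurableSet ({x} : Set (Finset.Iic n → S × A)) := measurableSet_singleton x
  beta_reduce at h'
  rw [Measure.compProd_apply_prod m1 .of_discrete,
    Measure.map_apply (by fun_prop) (m1.prod .of_discrete),
    Measure.restrict_singleton, lintegral_smul_measure, lintegral_dirac,
    Measure.map_apply (by fun_prop) m1] at h'
  rw [smul_eq_mul, mul_comm] at h'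
  exact h'.symm

/-- The characterization of `pathMeasure` by the probabilities of the histories:
`P(H_t = h_t) = μ(s_0) ∏_{i<t} π_i(a_i | h_i) p(s_{i+1} | s_i, a_i)`. -/
theorem pathMeasure_histOf (μ : PMF S) (π : Policy S A) (p : TransKernel S A)
    (x : ℕ → S × A) (t : ℕ) :
    pathMeasure μ π p {ω | histOf ω t = histOf x t} =
      μ (x 0).1 * ∏ i ∈ Finset.range t,
        (π i (histOf x i) (x i).2 * p (x i).1 (x i).2 (x (i + 1)).1) := by
  have full : ∀ n : ℕ, pathMeasure μ π p {ω | Preorder.frestrictLe (π := fun _ => S × A) n ω =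
        Preorder.frestrictLe (π := fun _ => S × A) n x} =
      μ (x 0).1 * (∏ i ∈ Finset.range n,
        (π i (histOf x i) (x i).2 * p (x i).1 (x i).2 (x (i + 1)).1)) *
        π n (histOf x n) (x n).2 := by
    intro n
    induction n with
    | zero =>
      have h := congrArg (fun m => m {x 0}) (pathMeasure_map_zero μ π p)
      beta_reduce at h
      rw [Measure.map_apply (by fun_prop) (measurableSet_singleton _),
        PMF.toMeasure_apply_singleton _ _ (measurableSet_singleton _), initPMF,
        bind_map_mk_apply] at h
      simp only [Finset.range_zero, Finset.prod_empty, mul_one]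
      have e : histOf x 0 = (Fin.elim0, (x 0).1) :=
        Prod.ext (funext fun i => i.elim0) rfl
      rw [e, ← h]
      congr 1
      ext ω
      simp only [Set.mem_ofPred_eq, Set.mem_preimage, Set.mem_singleton_iff]
      constructor
      · intro hω
        exact congrFun hω ⟨0, by simp⟩
      · intro hω
        funext ⟨i, hi⟩
        obtain rfl : i = 0 := by simpa using hi
        exact hω
    | succ n ih =>
      have h := pathMeasure_step μ π p n (Preorder.frestrictLe (π := fun _ => S × A) n x)
        {x (n + 1)}
      rw [ih, PMF.toMeasure_apply_singleton _ _ (measurableSet_singleton _), stepPMF,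
        bind_map_mk_apply] at h
      rw [Finset.prod_range_succ]
      trans
      · refine Eq.trans (congrArg _ ?_) h
        ext ω
        simp only [Set.mem_ofPred_eq, Set.mem_singleton_iff]
        constructor
        · intro hω
          exact ⟨funext fun i => congrFun hω ⟨i, by have := Finset.mem_Iic.1 i.2; simp; omega⟩,
            congrFun hω ⟨n + 1, by simp⟩⟩
        · rintro ⟨h1, h2⟩
          funext ⟨i, hi⟩
          rcases Nat.lt_or_ge n i with hlt | hge
          · obtain rfl : i = n + 1 := by have := Finset.mem_Iic.1 hi; omega
            exact h2
          · exact congrFun h1 ⟨i, by simpa using hge⟩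
      · simp only [Preorder.frestrictLe_apply]
        change p (x n).1 (x n).2 (x (n + 1)).1 * π (n + 1) (histOf x (n + 1)) (x (n + 1)).2 * _ = _
        ring
  cases t with
  | zero =>
    have h := congrArg (fun m => m (Prod.fst ⁻¹' {(x 0).1})) (pathMeasure_map_zero μ π p)
    beta_reduce at h
    rw [Measure.map_apply (by fun_prop) .of_discrete,
      ← PMF.toMeasure_map_apply Prod.fst _ _ measurable_fst .of_discrete, initPMF_map_fst,
      PMF.toMeasure_apply_singleton _ _ (measurableSet_singleton _)] at h
    simp only [Finset.range_zero, Finset.prod_empty, mul_one]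
    rw [← h]
    congr 1
    ext ω
    simp only [Set.mem_ofPred_eq, Set.mem_preimage, Set.mem_singleton_iff]
    exact ⟨fun hω => congrArg Prod.snd hω,
      fun hω => Prod.ext (funext fun i => i.elim0) hω⟩
  | succ n =>
    have h := pathMeasure_step μ π p n (Preorder.frestrictLe (π := fun _ => S × A) n x)
      (Prod.fst ⁻¹' {(x (n + 1)).1})
    rw [full n, ← PMF.toMeasure_map_apply Prod.fst _ _ measurable_fst .of_discrete,
      stepPMF_map_fst, PMF.toMeasure_apply_singleton _ _ (measurableSet_singleton _)] at h
    rw [Finset.prod_range_succ]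
    trans
    · refine Eq.trans (congrArg _ ?_) h
      ext ω
      simp only [Set.mem_ofPred_eq, Set.mem_preimage, Set.mem_singleton_iff]
      constructor
      · intro hω
        refine ⟨funext fun i => ?_, congrArg Prod.snd hω⟩
        exact congrFun (congrArg Prod.fst hω)
          ⟨i, Nat.lt_succ_of_le (Finset.mem_Iic.1 i.2)⟩
      · rintro ⟨h1, h2⟩
        refine Prod.ext (funext fun i => ?_) h2
        exact congrFun h1 ⟨i, by have := i.2; simp; omega⟩
    · simp only [Preorder.frestrictLe_apply]
      ring
end PathMeasureCharacterization

section Gain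

variable {S A : Type*} [Fintype S]

/-- `(α, v)` solves the modified multichain average-reward Bellman equations
`α(s) = max_a ∑_{s'} p(s'|s,a) α(s')` and
`v(s) = max_a {r(s,a) - α(s) + ∑_{s'} p(s'|s,a) v(s')}`. -/
def IsBellmanSolution (p : TransKernel S A) (r : Reward S A) (α v : S → ℝ) : Prop :=
  (∀ s, IsGreatest (Set.range fun a => ∑ s', (p s a s').toReal * α s') (α s)) ∧
  (∀ s, IsGreatest
    (Set.range fun a => (r s a : ℝ) - α s + ∑ s', (p s a s').toReal * v s') (v s))

/-- The optimal gain `α_p(s)`: the `α`-part of a solution of the Bellman equations. That part is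
unique if `p` is weakly communicating with all actions available, and then the infimum is over a
one-point set; in general, the optimal gain is the pointwise smallest `α`-part of a solution. -/
def optGain (p : TransKernel S A) (r : Reward S A) (s : S) : ℝ :=
  sInf {x | ∃ α v : S → ℝ, IsBellmanSolution p r α v ∧ α s = x}

/-- The regret `R_{r,p}(T) = ∑_{t<T} (α_p(X_0) - r(X_t, A_t))` on a sample path. -/
def regret (p : TransKernel S A) (r : Reward S A) (T : ℕ) (ω : ℕ → S × A) : ℝ :=
  ∑ t ∈ Finset.range T, (optGain p r (ω 0).1 - (r (ω t).1 (ω t).2 : ℝ))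

end Gain

section WeakCommunication

variable {S A : Type*} [Fintype A]

/-- The transition matrix `p_Δ(s'|s) = ∑_a p(s'|s,a) Δ(a|s)` of a stationary policy `Δ`. -/
def stationaryMatrix (p : TransKernel S A) (Δ : S → PMF A) : Matrix S S ℝ :=
  Matrix.of fun s s' => ∑ a, (p s a s').toReal * (Δ s a).toReal

open Classical in
/-- The state `s` is transient for the stochastic matrix `M`:
the expected number of visits to `s` from `s`, `∑_n M^n(s,s)`, is finite. -/
def IsTransientState [Fintype S] (M : Matrix S S ℝ) (s : S) : Prop :=
  Summable fun n : ℕ => (M ^ n) s s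

open Classical in
/-- The kernel `p` is weakly communicating (for stationary policies with decisions in `Q`):
there is a class `C` of states any two of which communicate under some stationary policy, and each
state outside `C` is transient under every stationary policy. -/
def IsWeaklyCommunicating [Fintype S] (Q : Set (PMF A)) (p : TransKernel S A) : Prop :=
  ∃ C : Set S, C.Nonempty ∧
    (∀ s ∈ C, ∀ s' ∈ C, ∃ Δ : S → PMF A, (∀ x, Δ x ∈ Q) ∧
      ∃ N : ℕ, 1 ≤ N ∧ 0 < (stationaryMatrix p Δ ^ N) s s') ∧
    (∀ s ∉ C, ∀ Δ : S → PMF A, (∀ x, Δ x ∈ Q) → IsTransientState (stationaryMatrix p Δ) s)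

end WeakCommunication

/-- `Π_RL(Q, P)`, relative to a class `R` of reward functions: the policies in `Π_H(Q)` with
sublinear expected regret for every `p ∈ P`, every initial law `μ` and every `r ∈ R`.
`R = Set.univ` is the class of all reward functions `S × A → [0, 1]`. -/
def PiRL {S A : Type*} [Fintype S] [Fintype A] [MeasurableSpace S] [MeasurableSpace A]
    [DiscreteMeasurableSpace S] [DiscreteMeasurableSpace A]
    (Q : Set (PMF A)) (P : Set (TransKernel S A)) (R : Set (Reward S A)) : Set (Policy S A) :=
  {π | π ∈ PiH Q ∧ ∀ p ∈ P, ∀ μ : PMF S, ∀ r ∈ R,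
    limsup (fun T : ℕ => 1 / (T : ℝ) * ∫ ω, regret p r T ω ∂(pathMeasure μ π p)) atTop = 0}

/-- Forget the first `m` state-action pairs of a history. -/
def Hist.drop {S A : Type*} {t : ℕ} (m : ℕ) (h : Hist S A t) : Hist S A (t - m) :=
  (fun i => h.1 ⟨m + i, by omega⟩, h.2)

/-- The doubling-epoch restart policy: it follows `π₀` at times `t < K`; for `n ≥ 0`, in the epoch
`2^n K ≤ t < 2^(n+1) K`, it discards all data collected before time `2^n K` and runs a fresh
instance of `π (2^n K)`. The index of the epoch that contains `t` is `⌊log₂ ⌊t / K⌋⌋`. -/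
def doublingRestart {S A : Type*} (K : ℕ) (π₀ : Policy S A) (π : ℕ → Policy S A) : Policy S A :=
  fun t h =>
    if t < K then π₀ t h
    else π (2 ^ Nat.log 2 (t / K) * K) (t - 2 ^ Nat.log 2 (t / K) * K)
      (Hist.drop (2 ^ Nat.log 2 (t / K) * K) h)

theorem doublingRestart_apply {S A : Type*} (K n t : ℕ) (hK : 1 ≤ K) (π₀ : Policy S A) (π : ℕ → Policy S A)
    (h1 : 2 ^ n * K ≤ t) (h2 : t < 2 ^ (n + 1) * K) (h : Hist S A t) :
    doublingRestart K π₀ π t h = π (2 ^ n * K) (t - 2 ^ n * K) (h.drop (2 ^ n * K)) := by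
  have hl : Nat.log 2 (t / K) = n := by
    rw [Nat.log_eq_iff (Or.inr ⟨by norm_num, ?_⟩)]
    · exact ⟨(Nat.le_div_iff_mul_le (by omega)).2 h1, (Nat.div_lt_iff_lt_mul (by omega)).2 h2⟩
    · have := (Nat.le_div_iff_mul_le (by omega)).2 h1
      have := Nat.two_pow_pos n
      omega
  have : ¬ t < K := by
    have := Nat.one_le_two_pow (n := n)
    nlinarith
  subst hl
  simp only [doublingRestart, if_neg this]

end

/-!
The regret is controlled from both sides through the average-reward optimality equation
`g + h(s) = max_a {r(s,a) + ∑ p(s'|s,a) h(s')}`. For a weakly communicating kernel it has a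
solution, and the optimal gain is the constant `g`
(`IsWeaklyCommunicating.exists_optGain_eq`). Both facts rest on one rigidity statement: a
solution of `w(s) = max_a ∑ p(s'|s,a) w(s')` is constant
(`IsWeaklyCommunicating.eq_of_isGreatest`). It makes the `α`-part of every Bellman solution
constant, and it bounds the centred discounted value functions, of which `h` is a limit.

*Lower bound.* Under every policy, the expected value of `g - r(X_t, A_t)` is at least the expected
increment of `h(X_t)`, so over every time interval the expected regret is at least `-2‖h‖`
(`neg_norm_le_sum_integral`).

*Upper bound.* In the epoch of length `L = 2^n K` that starts at time `L`, the restart policy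
behaves like `π(L)` started in the random state `X_L` (`pathMeasure_restart`). Since `S` is finite, the
assumed bounds for the initial laws `δ_s` hold with a common constant `F`, and the expected regret
of the epoch is at most `F L^η + L^(1-β) = o(L)` (`sum_integral_restart_le`). As the optimal gain is
constant, the regrets of the epochs add up. A horizon in the interior of an epoch costs only a
constant, since the expected regret of the remaining part of the epoch is at least `-2‖h‖`. Hence
the average expected regret tends to `0` (`tendsto_average_of_doubling`).

The rigidity statement is applied to deterministic maximizing decisions, so it needs the point
masses in `Q`. If `R` consists of all rewards, these are obtained from the regret bound: histories do not
contain rewards, so a single policy would have to be nearly optimal for the indicator rewards of two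
different actions, and hence there is only one action (`subsingleton_of_regret_le`).
-/

/-! ### Recurrence in finite stochastic matrices -/

theorem PMF.sum_toReal {α : Type*} [Fintype α] (q : PMF α) : ∑ a, (q a).toReal = 1 := by
  rw [← ENNReal.toReal_sum fun a _ => q.apply_ne_top a, ← tsum_fintype (L := .unconditional _),
    q.tsum_coe, ENNReal.toReal_one]

open Classical in
theorem Matrix.sum_pow_apply_eq_one {S : Type*} [Fintype S] {M : Matrix S S ℝ}
    (h1 : ∀ i, ∑ j, M i j = 1) (n : ℕ) (i : S) : ∑ j, (M ^ n) i j = 1 := by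
  induction n with
  | zero => simp [Matrix.one_apply]
  | succ n ih =>
    simp only [pow_succ, Matrix.mul_apply]
    rw [Finset.sum_comm]
    simp only [← Finset.mul_sum, h1, mul_one, ih]

open Classical in
theorem Matrix.mul_pow_apply_le {S : Type*} [Fintype S] {M : Matrix S S ℝ}
    (h0 : ∀ i j, 0 ≤ M i j) (m n : ℕ) (i j k : S) :
    (M ^ m) i j * (M ^ n) j k ≤ (M ^ (m + n)) i k := by
  rw [pow_add, Matrix.mul_apply]
  exact Finset.single_le_sum (f := fun j => (M ^ m) i j * (M ^ n) j k)
    (fun l _ => mul_nonneg (Matrix.pow_apply_nonneg h0 m i l) (Matrix.pow_apply_nonneg h0 n l k))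
    (Finset.mem_univ j)

open Classical in
theorem Matrix.mem_of_pow_apply_pos {S : Type*} [Fintype S] {M : Matrix S S ℝ}
    (h0 : ∀ i j, 0 ≤ M i j) {D : Set S} (hcl : ∀ i ∈ D, ∀ j, 0 < M i j → j ∈ D) (n : ℕ) {i j : S}
    (hi : i ∈ D) (h : 0 < (M ^ n) i j) : j ∈ D := by
  induction n generalizing j with
  | zero =>
    by_cases e : i = j
    · exact e ▸ hi
    · simp [e] at h
  | succ n ih =>
    rw [pow_succ, Matrix.mul_apply] at h
    obtain ⟨k, -, hk⟩ := Finset.exists_lt_of_sum_lt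
      (by simpa using h : ∑ k : S, (0 : ℝ) < ∑ k, (M ^ n) i k * M k j)
    have hk1 := Matrix.pow_apply_nonneg h0 n i k
    have hk2 := h0 k j
    exact hcl k (ih (hk1.lt_of_ne' (left_ne_zero_of_mul hk.ne'))) j
      (hk2.lt_of_ne' (right_ne_zero_of_mul hk.ne'))

open Classical in
/-- A nonempty closed set of a finite Markov chain contains a recurrent state. If the set of states
reachable from `s` is as small as possible, then `s` is reachable from each of them, so
`M ^ n s s → 0` would force `M ^ n s y → 0` for all `y`, although each row of `M ^ n` sums
to `1`. -/
theorem exists_not_isTransientState {S : Type*} [Fintype S] {M : Matrix S S ℝ}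
    (h0 : ∀ i j, 0 ≤ M i j) (h1 : ∀ i, ∑ j, M i j = 1) {D : Set S} (hD : D.Nonempty)
    (hcl : ∀ i ∈ D, ∀ j, 0 < M i j → j ∈ D) : ∃ s ∈ D, ¬ IsTransientState M s := by
  let reach : S → Finset S := fun s => Finset.univ.filter fun x => ∃ k, 0 < (M ^ k) s x
  have hreach : ∀ s x, x ∈ reach s ↔ ∃ k, 0 < (M ^ k) s x := fun s x => by simp [reach]
  obtain ⟨s, hs, hmin⟩ := Set.exists_min_image D (fun s => (reach s).card) D.toFinite hD
  refine ⟨s, hs, fun ht => ?_⟩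
  have hlim : Tendsto (fun n => (M ^ n) s s) atTop (𝓝 0) := ht.tendsto_atTop_zero
  have hy : ∀ y, Tendsto (fun n => (M ^ n) s y) atTop (𝓝 0) := by
    intro y
    by_cases hys : y ∈ reach s
    · have hyD : y ∈ D := by
        obtain ⟨k, hk⟩ := (hreach s y).1 hys
        exact Matrix.mem_of_pow_apply_pos h0 hcl k hs hk
      have hsub : reach y ⊆ reach s := by
        intro z hz
        obtain ⟨k, hk⟩ := (hreach s y).1 hys
        obtain ⟨l, hl⟩ := (hreach y z).1 hz
        exact (hreach s z).2 ⟨k + l, (mul_pos hk hl).trans_le (Matrix.mul_pow_apply_le h0 ..)⟩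
      have heq := Finset.eq_of_subset_of_card_le hsub (hmin y hyD)
      obtain ⟨k, hk⟩ := (hreach y s).1 (heq ▸ (hreach s s).2 ⟨0, by simp⟩)
      have hlim' := ((tendsto_add_atTop_iff_nat k).2 hlim).div_const ((M ^ k) y s)
      rw [zero_div] at hlim'
      refine squeeze_zero (fun n => Matrix.pow_apply_nonneg h0 n s y) (fun n => ?_) hlim'
      rw [le_div_iff₀ hk]
      exact Matrix.mul_pow_apply_le h0 ..
    · have : ∀ n, (M ^ n) s y = 0 := fun n => le_antisymm
        (not_lt.1 fun h => hys ((hreach s y).2 ⟨n, h⟩)) (Matrix.pow_apply_nonneg h0 n s y)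
      simp [this]
  have hsum := tendsto_finsetSum Finset.univ fun y _ => hy y
  simp only [Matrix.sum_pow_apply_eq_one h1, Finset.sum_const_zero] at hsum
  exact one_ne_zero (tendsto_nhds_unique tendsto_const_nhds hsum)

theorem stationaryMatrix_nonneg {S A : Type*} [Fintype A] (p : TransKernel S A) (Δ : S → PMF A)
    (s s' : S) : 0 ≤ stationaryMatrix p Δ s s' := by
  rw [stationaryMatrix, Matrix.of_apply]
  positivity

theorem sum_stationaryMatrix {S A : Type*} [Fintype S] [Fintype A] (p : TransKernel S A)
    (Δ : S → PMF A) (s : S) : ∑ s', stationaryMatrix p Δ s s' = 1 := by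
  simp only [stationaryMatrix, Matrix.of_apply]
  rw [Finset.sum_comm]
  simp only [← Finset.sum_mul, PMF.sum_toReal, one_mul]

theorem exists_pos_of_stationaryMatrix_pos {S A : Type*} [Fintype A] {p : TransKernel S A}
    {Δ : S → PMF A} {s s' : S} (h : 0 < stationaryMatrix p Δ s s') :
    ∃ a, 0 < (p s a s').toReal ∧ Δ s a ≠ 0 := by
  rw [stationaryMatrix, Matrix.of_apply] at h
  obtain ⟨a, -, ha⟩ := Finset.exists_lt_of_sum_lt
    (by simpa using h : ∑ a : A, (0 : ℝ) < ∑ a, (p s a s').toReal * (Δ s a).toReal)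
  refine ⟨a, ENNReal.toReal_nonneg.lt_of_ne' (left_ne_zero_of_mul ha.ne'), fun h => ?_⟩
  simp [h] at ha

/-! ### The optimality equation of a weakly communicating kernel -/

section Bellman

variable {S A : Type*} [Fintype S]

/-- The expectation of `w` after one step from `s` under the action `a`. -/
noncomputable def nextMean (p : TransKernel S A) (w : S → ℝ) (s : S) (a : A) : ℝ :=
  ∑ s', (p s a s').toReal * w s'

theorem nextMean_le (p : TransKernel S A) {w : S → ℝ} {c : ℝ} (h : ∀ s, w s ≤ c) (s : S) (a : A) :
    nextMean p w s a ≤ c := by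
  calc nextMean p w s a ≤ ∑ s', (p s a s').toReal * c :=
        Finset.sum_le_sum fun s' _ => mul_le_mul_of_nonneg_left (h s') ENNReal.toReal_nonneg
    _ = c := by rw [← Finset.sum_mul, PMF.sum_toReal, one_mul]

theorem nextMean_neg (p : TransKernel S A) (w : S → ℝ) (s : S) (a : A) :
    nextMean p (fun x => -w x) s a = -nextMean p w s a := by
  simp [nextMean]

theorem nextMean_const_mul (p : TransKernel S A) (w : S → ℝ) (c : ℝ) (s : S) (a : A) :
    nextMean p (fun x => c * w x) s a = c * nextMean p w s a := by
  simp only [nextMean, Finset.mul_sum]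
  exact Finset.sum_congr rfl fun _ _ => by ring

theorem nextMean_sub (p : TransKernel S A) (w w' : S → ℝ) (s : S) (a : A) :
    nextMean p (fun x => w x - w' x) s a = nextMean p w s a - nextMean p w' s a := by
  simp [nextMean, mul_sub, Finset.sum_sub_distrib]

theorem nextMean_const (p : TransKernel S A) (c : ℝ) (s : S) (a : A) :
    nextMean p (fun _ => c) s a = c := by
  rw [nextMean, ← Finset.sum_mul, PMF.sum_toReal, one_mul]

/-- If `c` bounds `w` and is its mean after one step, then `w = c` at all possible successors. -/
theorem eq_of_le_nextMean {p : TransKernel S A} {w : S → ℝ} {c : ℝ} (h : ∀ s, w s ≤ c) {s : S}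
    {a : A} (hc : c ≤ nextMean p w s a) {s' : S} (hp : 0 < (p s a s').toReal) : w s' = c := by
  have hsum : ∑ x, (p s a x).toReal * (c - w x) ≤ 0 := by
    simp only [mul_sub, Finset.sum_sub_distrib]
    rw [← Finset.sum_mul, PMF.sum_toReal, one_mul]
    exact sub_nonpos.2 hc
  have hle := (Finset.single_le_sum (f := fun x => (p s a x).toReal * (c - w x))
    (fun x _ => mul_nonneg ENNReal.toReal_nonneg (sub_nonneg.2 (h x))) (Finset.mem_univ s')).trans
    hsum
  exact le_antisymm (h s') (by nlinarith)

theorem eq_of_nextMean_le {p : TransKernel S A} {w : S → ℝ} {c : ℝ} (h : ∀ s, c ≤ w s) {s : S}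
    {a : A} (hc : nextMean p w s a ≤ c) {s' : S} (hp : 0 < (p s a s').toReal) : w s' = c := by
  have := eq_of_le_nextMean (w := fun x => -w x) (c := -c) (fun x => neg_le_neg (h x))
    (by rw [nextMean_neg]; exact neg_le_neg hc) hp
  linarith

/-- A solution of `w(s) = max_a ∑ p(s'|s,a) w(s')` is constant. The set where `w` is largest is
closed under a maximizing stationary policy and the set where `w` is smallest is closed under every
action, so both contain recurrent states, which lie in the communicating class `C`; and a path from
a minimum to a maximum cannot leave the second set. -/
theorem IsWeaklyCommunicating.eq_of_isGreatest [Fintype A] {Q : Set (PMF A)} {p : TransKernel S A}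
    (hp : IsWeaklyCommunicating Q p) (hQ : ∀ a, PMF.pure a ∈ Q) {w : S → ℝ}
    (hw : ∀ s, IsGreatest (Set.range (nextMean p w s)) (w s)) (s s' : S) : w s = w s' := by
  classical
  obtain ⟨C, -, hC, htr⟩ := hp
  choose δ hδ using fun s => (hw s).1
  -- A set that is closed under the maximizer `δ` contains a recurrent state, hence meets `C`.
  have hrec : ∀ D : Set S, D.Nonempty → (∀ x ∈ D, ∀ y, 0 < (p x (δ x) y).toReal → y ∈ D) →
      ∃ c ∈ C, c ∈ D := by
    intro D hD hcl
    obtain ⟨c, hcD, hc⟩ := exists_not_isTransientState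
      (stationaryMatrix_nonneg p fun x => PMF.pure (δ x))
      (sum_stationaryMatrix p fun x => PMF.pure (δ x)) hD (fun x hx y hxy => by
        obtain ⟨a, ha, ha'⟩ := exists_pos_of_stationaryMatrix_pos hxy
        obtain rfl : a = δ x := by
          by_contra hne
          exact ha' (PMF.pure_apply_of_ne _ _ hne)
        exact hcl x hx y ha)
    by_contra! hcon
    exact hc (htr c (fun h => hcon c h hcD) _ fun x => hQ _)
  have : Nonempty S := ⟨s⟩
  obtain ⟨M, hM⟩ := Finite.exists_max w
  obtain ⟨m, hm⟩ := Finite.exists_min w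
  have hmcl : ∀ x, w x = w m → ∀ a y, 0 < (p x a y).toReal → w y = w m := fun x hx a y hxy =>
    eq_of_nextMean_le hm (hx ▸ (hw x).2 ⟨a, rfl⟩) hxy
  obtain ⟨c, hcC, hc⟩ := hrec {x | w x = w M} ⟨M, rfl⟩ fun x hx y hxy =>
    eq_of_le_nextMean hM ((hδ x).trans hx).ge hxy
  obtain ⟨d, hdC, hd⟩ := hrec {x | w x = w m} ⟨m, rfl⟩ fun x hx y hxy => hmcl x hx _ y hxy
  obtain ⟨Δ, -, N, -, hN⟩ := hC d hdC c hcC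
  have hcm : w c = w m := Matrix.mem_of_pow_apply_pos (stationaryMatrix_nonneg p Δ)
    (D := {x | w x = w m}) (fun x hx y hxy => by
      obtain ⟨a, ha, -⟩ := exists_pos_of_stationaryMatrix_pos hxy
      exact hmcl x hx a y ha) N hd hN
  have hc' : w c = w M := hc
  linarith [hM s, hM s', hm s, hm s']

end Bellman

section Existence

variable {S A : Type*} [Fintype S]

theorem nextMean_mono (p : TransKernel S A) {w w' : S → ℝ} (h : ∀ s, w s ≤ w' s) (s : S) (a : A) :
    nextMean p w s a ≤ nextMean p w' s a :=
  Finset.sum_le_sum fun s' _ => mul_le_mul_of_nonneg_left (h s') ENNReal.toReal_nonneg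

theorem abs_nextMean_sub_le (p : TransKernel S A) (w w' : S → ℝ) (s : S) (a : A) :
    |nextMean p w s a - nextMean p w' s a| ≤ dist w w' := by
  have h : ∀ x, |w x - w' x| ≤ dist w w' := fun x => by
    rw [← Real.dist_eq]
    exact dist_le_pi_dist w w' x
  rw [← nextMean_sub, abs_le]
  constructor
  · have := nextMean_le p (w := fun x => -(w x - w' x)) (c := dist w w')
      (fun x => (neg_le_abs _).trans (h x)) s a
    rw [nextMean_neg] at this
    linarith
  · exact nextMean_le p (fun x => (le_abs_self _).trans (h x)) s a

theorem Finset.abs_sup'_sub_sup'_le {ι : Type*} {s : Finset ι} (hs : s.Nonempty) {f g : ι → ℝ}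
    {c : ℝ} (h : ∀ i ∈ s, |f i - g i| ≤ c) : |s.sup' hs f - s.sup' hs g| ≤ c := by
  rw [abs_le, neg_le_sub_iff_le_add, sub_le_iff_le_add']
  constructor
  · refine Finset.sup'_le _ _ fun i hi => ?_
    linarith [Finset.le_sup' f hi, (abs_le.1 (h i hi)).1]
  · refine Finset.sup'_le _ _ fun i hi => ?_
    linarith [Finset.le_sup' g hi, (abs_le.1 (h i hi)).2]

theorem isGreatest_range_sup' {ι : Type*} [Fintype ι] [Nonempty ι] (f : ι → ℝ) :
    IsGreatest (Set.range f) (Finset.univ.sup' Finset.univ_nonempty f) := by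
  obtain ⟨i, -, hi⟩ := Finset.exists_mem_eq_sup' Finset.univ_nonempty f
  exact ⟨⟨i, hi.symm⟩, by rintro _ ⟨j, rfl⟩; exact Finset.le_sup' f (Finset.mem_univ j)⟩

/-- The discounted optimality equation has a solution with values in `[0, 1 / (1 - γ)]`. -/
theorem exists_discounted_value [Fintype A] [Nonempty A] (p : TransKernel S A)
    (r : Reward S A) {γ : ℝ} (h0 : 0 ≤ γ) (h1 : γ < 1) :
    ∃ V : S → ℝ, (∀ s, V s = Finset.univ.sup' Finset.univ_nonempty
      fun a => (r s a : ℝ) + γ * nextMean p V s a) ∧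
      ∀ s, 0 ≤ (1 - γ) * V s ∧ (1 - γ) * V s ≤ 1 := by
  let F : (S → ℝ) → S → ℝ := fun V s => Finset.univ.sup' Finset.univ_nonempty
      fun a => (r s a : ℝ) + γ * nextMean p V s a
  have hF : ContractingWith ⟨γ, h0⟩ F := by
    refine ⟨by exact_mod_cast h1, LipschitzWith.of_dist_le_mul fun V W => ?_⟩
    refine (dist_pi_le_iff (mul_nonneg h0 dist_nonneg)).2 fun s => ?_
    rw [Real.dist_eq]
    refine Finset.abs_sup'_sub_sup'_le _ fun a _ => ?_
    rw [add_sub_add_left_eq_sub, ← mul_sub, abs_mul, abs_of_nonneg h0]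
    exact mul_le_mul_of_nonneg_left (abs_nextMean_sub_le p V W s a) h0
  obtain ⟨V, hV⟩ : ∃ V, F V = V := ⟨_, hF.fixedPoint_isFixedPt⟩
  have hV' : ∀ s, IsGreatest (Set.range fun a => (r s a : ℝ) + γ * nextMean p V s a) (V s) :=
    fun s => (congrFun hV s) ▸ isGreatest_range_sup' _
  refine ⟨V, fun s => (congrFun hV s).symm, fun s => ?_⟩
  have : Nonempty S := ⟨s⟩
  constructor
  · obtain ⟨m, hm⟩ := Finite.exists_min V
    have a := Classical.arbitrary A
    have hle := (hV' m).2 ⟨a, rfl⟩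
    have hP : V m ≤ nextMean p V m a := by
      have := nextMean_mono p (w := fun _ => V m) hm m a
      rwa [nextMean_const] at this
    have hr := (r m a).2.1
    dsimp only at hle
    have : 0 ≤ V m := by
      have h2 := mul_le_mul_of_nonneg_left hP h0
      by_contra! hneg
      nlinarith
    exact mul_nonneg (by linarith) (this.trans (hm s))
  · obtain ⟨m, hm⟩ := Finite.exists_max V
    obtain ⟨a, ha⟩ := (hV' m).1
    have hP := mul_le_mul_of_nonneg_left (nextMean_le p hm m a) h0
    have hr := (r m a).2.2
    dsimp only at ha
    have := mul_le_mul_of_nonneg_left (hm s) (by linarith : 0 ≤ 1 - γ)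
    linarith

/-- The average-reward optimality equation `g + h(s) = max_a {r(s,a) + ∑ p(s'|s,a) h(s')}` of a
weakly communicating kernel has a solution. It is a limit of discounted equations, in which the
value function, centred at a state, is scaled to the unit ball: the scale cannot tend to `0`, since
the limit would be a nonconstant solution of `w(s) = max_a ∑ p(s'|s,a) w(s')`. -/
theorem IsWeaklyCommunicating.exists_average_value [Fintype A] [Nonempty A] {Q : Set (PMF A)}
    {p : TransKernel S A} (hp : IsWeaklyCommunicating Q p) (hQ : ∀ a, PMF.pure a ∈ Q)
    (r : Reward S A) :
    ∃ (g : ℝ) (h : S → ℝ),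
      ∀ s, IsGreatest (Set.range fun a => (r s a : ℝ) + nextMean p h s a) (g + h s) := by
  obtain ⟨s₀⟩ : Nonempty S := hp.choose_spec.1.nonempty
  obtain ⟨γ, -, hγ, hγlim⟩ := exists_seq_strictMono_tendsto' (zero_lt_one (α := ℝ))
  choose V hV hVb using fun n => exists_discounted_value p r (hγ n).1.le (hγ n).2
  -- The centred value functions `h n` solve the optimality equation with discount `γ n` and
  -- constant `g n`; the factor `c n` scales them into the unit ball.
  let h : ℕ → S → ℝ := fun n s => V n s - V n s₀
  let c : ℕ → ℝ := fun n => (1 + ‖h n‖)⁻¹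
  let w : ℕ → S → ℝ := fun n s => c n * h n s
  let g : ℕ → ℝ := fun n => (1 - γ n) * V n s₀
  have hpos : ∀ n, 0 < 1 + ‖h n‖ := fun n => by positivity
  have hc0 : ∀ n, 0 < c n := fun n => inv_pos.2 (hpos n)
  have hc1 : ∀ n, c n ≤ 1 := fun n => inv_le_one_of_one_le₀ (by simp)
  have hwn : ∀ n, ‖w n‖ = 1 - c n := fun n => by
    have : w n = c n • h n := rfl
    rw [this, norm_smul, Real.norm_of_nonneg (hc0 n).le]
    have : c n * (1 + ‖h n‖) = 1 := inv_mul_cancel₀ (hpos n).ne'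
    linarith
  let T : ℝ × ℝ × (S → ℝ) → S → ℝ := fun x s => Finset.univ.sup' Finset.univ_nonempty
      fun a => x.1 * (r s a : ℝ) + x.2.1 * nextMean p x.2.2 s a
  have hT : ∀ s, Continuous fun x => T x s := fun s =>
    Continuous.finset_sup'_apply _ fun a _ => by unfold nextMean; fun_prop
  have heq : ∀ n s, w n s + c n * g n = T (c n, γ n, w n) s := by
    intro n s
    have e : ∀ a, c n * (r s a : ℝ) + γ n * nextMean p (w n) s a =
        c n * ((r s a + γ n * nextMean p (V n) s a) - γ n * V n s₀) := fun a => by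
      have e1 : nextMean p (w n) s a = c n * (nextMean p (V n) s a - V n s₀) := by
        simp only [w, h]
        rw [nextMean_const_mul, nextMean_sub, nextMean_const]
      rw [e1]
      ring
    have h1 : IsGreatest (Set.range fun a => c n * (r s a : ℝ) + γ n * nextMean p (w n) s a)
        (w n s + c n * g n) := by
      have hg : IsGreatest (Set.range fun a => (r s a : ℝ) + γ n * nextMean p (V n) s a) (V n s) :=
        (hV n s) ▸ isGreatest_range_sup' _
      have e2 : w n s + c n * g n = c n * (V n s - γ n * V n s₀) := by
        simp only [w, h, g]
        ring
      rw [e2]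
      constructor
      · obtain ⟨a, ha⟩ := hg.1
        exact ⟨a, by rw [← ha]; exact e a⟩
      · rintro _ ⟨a, rfl⟩
        dsimp only
        rw [e a]
        exact mul_le_mul_of_nonneg_left (sub_le_sub_right (hg.2 ⟨a, rfl⟩) _) (hc0 n).le
    exact h1.unique (isGreatest_range_sup' _)
  obtain ⟨⟨c', g', w'⟩, hmem, φ, hφ, hlim⟩ :=
    ((isCompact_Icc (a := (0 : ℝ)) (b := 1)).prod ((isCompact_Icc (a := (0 : ℝ)) (b := 1)).prod
      (isCompact_closedBall (0 : S → ℝ) 1))).tendsto_subseq (x := fun n => (c n, g n, w n))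
      fun n => ⟨⟨(hc0 n).le, hc1 n⟩, hVb n s₀, by
        rw [mem_closedBall_zero_iff, hwn n]
        linarith [hc0 n]⟩
  have lc : Tendsto (fun k => c (φ k)) atTop (𝓝 c') :=
    (continuous_fst.tendsto _).comp hlim
  have lg : Tendsto (fun k => g (φ k)) atTop (𝓝 g') :=
    ((continuous_fst.comp continuous_snd).tendsto _).comp hlim
  have lw : Tendsto (fun k => w (φ k)) atTop (𝓝 w') :=
    ((continuous_snd.comp continuous_snd).tendsto _).comp hlim
  have lγ : Tendsto (fun k => γ (φ k)) atTop (𝓝 1) := hγlim.comp hφ.tendsto_atTop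
  have hlimeq : ∀ s, w' s + c' * g' = T (c', 1, w') s := fun s => by
    have l1 := (((continuous_apply s).tendsto w').comp lw).add (lc.mul lg)
    have l2 := ((hT s).tendsto (c', 1, w')).comp (lc.prodMk_nhds (lγ.prodMk_nhds lw))
    refine tendsto_nhds_unique l1 (l2.congr fun k => ?_)
    exact (heq (φ k) s).symm
  have hgr : ∀ s, IsGreatest (Set.range fun a => c' * (r s a : ℝ) + nextMean p w' s a)
      (w' s + c' * g') := fun s => by
    rw [hlimeq s]
    simpa only [T, one_mul] using
      isGreatest_range_sup' (fun a => c' * (r s a : ℝ) + 1 * nextMean p w' s a)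
  have hnorm : ‖w'‖ = 1 - c' := tendsto_nhds_unique lw.norm
    ((tendsto_const_nhds.sub lc).congr fun k => (hwn (φ k)).symm)
  have hw0 : w' s₀ = 0 := tendsto_nhds_unique (((continuous_apply s₀).tendsto w').comp lw)
    (tendsto_const_nhds.congr fun k => by simp [w, h])
  -- If `c' = 0`, the limit `w'` is constant and vanishes at `s₀`, although `‖w'‖ = 1`.
  have hc' : c' ≠ 0 := by
    rintro rfl
    have hconst := hp.eq_of_isGreatest hQ (w := w') fun s => by simpa using hgr s
    have : w' = 0 := funext fun s => (hconst s s₀).trans hw0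
    simp [this] at hnorm
  have hc'' : 0 < c' := lt_of_le_of_ne hmem.1.1 hc'.symm
  refine ⟨g', fun s => c'⁻¹ * w' s, fun s => ?_⟩
  have e : ∀ a, (r s a : ℝ) + nextMean p (fun s => c'⁻¹ * w' s) s a =
      c'⁻¹ * (c' * (r s a : ℝ) + nextMean p w' s a) := fun a => by
    rw [nextMean_const_mul]
    field_simp
  have e2 : g' + c'⁻¹ * w' s = c'⁻¹ * (w' s + c' * g') := by field_simp; ring
  rw [e2]
  constructor
  · obtain ⟨a, ha⟩ := (hgr s).1
    exact ⟨a, by rw [← ha]; exact e a⟩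
  · rintro _ ⟨a, rfl⟩
    dsimp only
    rw [e a]
    exact mul_le_mul_of_nonneg_left ((hgr s).2 ⟨a, rfl⟩) (inv_pos.2 hc'').le

/-- The optimal gain of a weakly communicating kernel is a constant `g ≤ 1` that solves the
average-reward optimality equation together with some `h`. -/
theorem IsWeaklyCommunicating.exists_optGain_eq [Fintype A] [Nonempty A] {Q : Set (PMF A)}
    {p : TransKernel S A} (hp : IsWeaklyCommunicating Q p) (hQ : ∀ a, PMF.pure a ∈ Q)
    (r : Reward S A) :
    ∃ (g : ℝ) (h : S → ℝ), g ≤ 1 ∧ (∀ s, optGain p r s = g) ∧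
      ∀ s a, (r s a : ℝ) + nextMean p h s a ≤ g + h s := by
  obtain ⟨g, h, hg⟩ := hp.exists_average_value hQ r
  obtain ⟨s₀⟩ : Nonempty S := hp.choose_spec.1.nonempty
  have : Nonempty S := ⟨s₀⟩
  -- The constant in the optimality equation is unique: compare two solutions where `h₁ - h₂` is
  -- largest.
  have hle : ∀ {g₁ g₂ : ℝ} {h₁ h₂ : S → ℝ},
      (∀ s, IsGreatest (Set.range fun a => (r s a : ℝ) + nextMean p h₁ s a) (g₁ + h₁ s)) →
      (∀ s, IsGreatest (Set.range fun a => (r s a : ℝ) + nextMean p h₂ s a) (g₂ + h₂ s)) →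
      g₁ ≤ g₂ := by
    intro g₁ g₂ h₁ h₂ H₁ H₂
    obtain ⟨m, hm⟩ := Finite.exists_max fun s => h₁ s - h₂ s
    obtain ⟨a, ha⟩ := (H₁ m).1
    have h2 := (H₂ m).2 ⟨a, rfl⟩
    have h3 := nextMean_le p hm m a
    rw [nextMean_sub] at h3
    dsimp only at ha h2
    linarith
  refine ⟨g, h, ?_, fun s => ?_, fun s a => (hg s).2 ⟨a, rfl⟩⟩
  · obtain ⟨m, hm⟩ := Finite.exists_max h
    obtain ⟨a, ha⟩ := (hg m).1
    have hr := (r m a).2.2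
    have := nextMean_le p hm m a
    dsimp only at ha
    linarith
  · have : {x | ∃ α v : S → ℝ, IsBellmanSolution p r α v ∧ α s = x} = {g} := by
      refine Set.Subset.antisymm ?_
        (Set.singleton_subset_iff.2 ⟨fun _ => g, h, ⟨fun s => ?_, fun s => ?_⟩, rfl⟩)
      · rintro _ ⟨α, v, ⟨hα, hv⟩, rfl⟩
        have hconst : ∀ x, α x = α s := fun x => hp.eq_of_isGreatest hQ hα x s
        have hv' : ∀ x, IsGreatest (Set.range fun a => (r x a : ℝ) + nextMean p v x a)
            (α s + v x) := fun x => by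
          obtain ⟨⟨a, ha⟩, hub⟩ := hv x
          rw [hconst x] at ha hub
          refine ⟨⟨a, ?_⟩, ?_⟩
          · rw [← ha]
            simp only [nextMean]
            ring
          · rintro _ ⟨b, rfl⟩
            have := hub ⟨b, rfl⟩
            simp only [nextMean] at this ⊢
            linarith
        exact le_antisymm (hle hv' hg) (hle hg hv')
      · have e : ∀ a : A, ∑ s', (p s a s').toReal * g = g := fun a => nextMean_const p g s a
        simp only [e]
        rw [Set.range_const]
        exact isGreatest_singleton
      · obtain ⟨⟨a, ha⟩, hub⟩ := hg s
        refine ⟨⟨a, ?_⟩, ?_⟩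
        · simp only [nextMean] at ha ⊢
          linarith
        · rintro _ ⟨b, rfl⟩
          have := hub ⟨b, rfl⟩
          simp only [nextMean] at this ⊢
          linarith
    rw [optGain, this, csInf_singleton]

end Existence

/-! ### The law of a controlled process after a fixed time -/

section Paths

theorem measure_eq_sum_fiber {Ω β : Type*} [MeasurableSpace Ω] [MeasurableSpace β] [Fintype β]
    [DiscreteMeasurableSpace β] (μ : Measure Ω) {X : Ω → β} (hX : Measurable X) (F : Set Ω) :
    μ F = ∑ b, μ {ω | X ω = b ∧ ω ∈ F} := by
  have h := sum_measure_preimage_singleton (μ := μ.restrict F) (f := X) Finset.univ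
    fun b _ => hX (measurableSet_singleton b)
  simp only [Finset.coe_univ, Set.preimage_univ, Measure.restrict_apply_univ] at h
  rw [← h]
  refine Finset.sum_congr rfl fun b _ => ?_
  rw [Measure.restrict_apply (hX (measurableSet_singleton b))]
  rfl

theorem integral_comp_eq_sum {Ω β : Type*} [MeasurableSpace Ω] [MeasurableSpace β] [Fintype β]
    [DiscreteMeasurableSpace β] (μ : Measure Ω) [IsFiniteMeasure μ] {X : Ω → β}
    (hX : Measurable X) (f : β → ℝ) :
    ∫ ω, f (X ω) ∂μ = ∑ b, μ.real {ω | X ω = b} * f b := by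
  rw [← integral_map (f := f) hX.aemeasurable (by fun_prop),
    integral_fintype (Integrable.of_finite)]
  refine Finset.sum_congr rfl fun b _ => ?_
  rw [map_measureReal_apply hX (measurableSet_singleton b)]
  rfl

theorem integrable_comp_of_finite {Ω β : Type*} [MeasurableSpace Ω] [MeasurableSpace β] [Finite β]
    [DiscreteMeasurableSpace β] (μ : Measure Ω) [IsFiniteMeasure μ] {X : Ω → β}
    (hX : Measurable X) (f : β → ℝ) : Integrable (fun ω => f (X ω)) μ :=
  Integrable.comp_measurable (f := X) (g := f) Integrable.of_finite hX

theorem measurable_histOf {S A : Type*} [MeasurableSpace S] [MeasurableSpace A] (t : ℕ) :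
    Measurable fun ω : ℕ → S × A => histOf ω t := by
  unfold histOf
  fun_prop

theorem histOf_surjective {S A : Type*} [Nonempty A] (t : ℕ) (h : Hist S A t) :
    ∃ ω : ℕ → S × A, histOf ω t = h := by
  refine ⟨fun i => if hi : i < t then h.1 ⟨i, hi⟩ else (h.2, Classical.arbitrary A), ?_⟩
  refine Prod.ext (funext fun i => ?_) ?_
  · simp [histOf]
  · simp [histOf]

theorem histOf_succ_eq_iff {S A : Type*} (ω x : ℕ → S × A) (t : ℕ) :
    histOf ω (t + 1) = histOf x (t + 1) ↔
      histOf ω t = histOf x t ∧ (ω t).2 = (x t).2 ∧ (ω (t + 1)).1 = (x (t + 1)).1 := by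
  simp only [histOf, Prod.ext_iff (x := (_, _)), funext_iff, Fin.forall_fin_succ', Fin.val_castSucc,
    Fin.val_last]
  tauto

variable {S A : Type*} [Fintype S] [Fintype A] [MeasurableSpace S] [MeasurableSpace A]
  [DiscreteMeasurableSpace S] [DiscreteMeasurableSpace A]

theorem pathMeasure_next_state (μ : PMF S) (π : Policy S A) (p : TransKernel S A) (t : ℕ)
    (y : S × A) (s' : S) :
    pathMeasure μ π p {ω | ω t = y ∧ (ω (t + 1)).1 = s'} =
      p y.1 y.2 s' * pathMeasure μ π p {ω | ω t = y} := by
  have hX : Measurable (Preorder.frestrictLe (π := fun _ => S × A) t) :=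
    Preorder.measurable_frestrictLe t
  rw [measure_eq_sum_fiber _ hX, measure_eq_sum_fiber _ hX {ω | ω t = y}, Finset.mul_sum]
  refine Finset.sum_congr rfl fun x _ => ?_
  by_cases hx : x ⟨t, by simp⟩ = y
  · have h1 : {ω | Preorder.frestrictLe (π := fun _ => S × A) t ω = x ∧ ω ∈ {ω | ω t = y}} =
        {ω | Preorder.frestrictLe (π := fun _ => S × A) t ω = x} := by
      ext ω
      simp only [Set.mem_ofPred_eq]
      exact ⟨fun h => h.1, fun h => ⟨h, hx ▸ congrFun h ⟨t, by simp⟩⟩⟩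
    have h2 : {ω | Preorder.frestrictLe (π := fun _ => S × A) t ω = x ∧
          ω ∈ {ω | ω t = y ∧ (ω (t + 1)).1 = s'}} =
        {ω | Preorder.frestrictLe (π := fun _ => S × A) t ω = x ∧
          ω (t + 1) ∈ Prod.fst ⁻¹' {s'}} := by
      ext ω
      simp only [Set.mem_ofPred_eq, Set.mem_preimage, Set.mem_singleton_iff]
      exact ⟨fun h => ⟨h.1, h.2.2⟩, fun h => ⟨h.1, hx ▸ congrFun h.1 ⟨t, by simp⟩, h.2⟩⟩
    rw [h1, h2, pathMeasure_step,
      ← PMF.toMeasure_map_apply Prod.fst _ _ measurable_fst .of_discrete,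
      stepPMF_map_fst, PMF.toMeasure_apply_singleton _ _ (measurableSet_singleton _), hx]
  · have h1 : ∀ F : Set (ℕ → S × A), F ⊆ {ω | ω t = y} →
        {ω | Preorder.frestrictLe (π := fun _ => S × A) t ω = x ∧ ω ∈ F} = ∅ := by
      intro F hF
      refine Set.eq_empty_iff_forall_notMem.2 fun ω hω => hx ?_
      have h2 : ω t = y := hF hω.2
      exact h2 ▸ (congrFun hω.1 ⟨t, by simp⟩).symm
    rw [h1 _ fun ω hω => hω.1, h1 _ subset_rfl]
    simp

theorem integral_next_state (μ : PMF S) (π : Policy S A) (p : TransKernel S A) (t : ℕ)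
    (v : S → ℝ) :
    ∫ ω, v (ω (t + 1)).1 ∂(pathMeasure μ π p) =
      ∫ ω, nextMean p v (ω t).1 (ω t).2 ∂(pathMeasure μ π p) := by
  rw [integral_comp_eq_sum _ (X := fun ω : ℕ → S × A => (ω (t + 1)).1) (by fun_prop) v,
    integral_comp_eq_sum _ (X := fun ω : ℕ → S × A => ω t) (by fun_prop)
      fun y => nextMean p v y.1 y.2]
  simp only [nextMean, Finset.mul_sum]
  rw [Finset.sum_comm]
  refine Finset.sum_congr rfl fun s' _ => ?_
  rw [Measure.real, measure_eq_sum_fiber _ (X := fun ω : ℕ → S × A => ω t) (by fun_prop),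
    ENNReal.toReal_sum fun _ _ => measure_ne_top _ _, Finset.sum_mul]
  refine Finset.sum_congr rfl fun y _ => ?_
  have := pathMeasure_next_state μ π p t y s'
  simp only [Set.mem_ofPred_eq]
  rw [this, ENNReal.toReal_mul, Measure.real]
  ring

/-- No policy beats the gain `g` by more than a constant: by the optimality equation,
`g - r(X_t, A_t)` dominates in expectation the increment of `h(X_t)`. -/
theorem neg_norm_le_sum_integral {p : TransKernel S A} {r : Reward S A} {g : ℝ} {h : S → ℝ}
    (hg : ∀ s a, (r s a : ℝ) + nextMean p h s a ≤ g + h s) (μ : PMF S) (π : Policy S A)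
    {m n : ℕ} (hmn : m ≤ n) :
    -(2 * ‖h‖) ≤
      ∑ t ∈ Finset.Ico m n, ∫ ω, (g - (r (ω t).1 (ω t).2 : ℝ)) ∂(pathMeasure μ π p) := by
  have hint : ∀ t (f : S × A → ℝ), Integrable (fun ω => f (ω t)) (pathMeasure μ π p) :=
    fun t f => integrable_comp_of_finite _ (by fun_prop) f
  have hstep : ∀ t, ∫ ω, h (ω (t + 1)).1 ∂(pathMeasure μ π p) - ∫ ω, h (ω t).1 ∂(pathMeasure μ π p)
      ≤ ∫ ω, (g - (r (ω t).1 (ω t).2 : ℝ)) ∂(pathMeasure μ π p) := by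
    intro t
    rw [integral_next_state, ← integral_sub (hint t fun y => nextMean p h y.1 y.2)
      (hint t fun y => h y.1)]
    refine integral_mono ((hint t fun y => nextMean p h y.1 y.2).sub (hint t fun y => h y.1))
      (hint t fun y => g - (r y.1 y.2 : ℝ)) fun ω => ?_
    have := hg (ω t).1 (ω t).2
    dsimp only
    linarith
  have hbound : ∀ t, |∫ ω, h (ω t).1 ∂(pathMeasure μ π p)| ≤ ‖h‖ := by
    intro t
    have := norm_integral_le_of_norm_le_const (μ := pathMeasure μ π p)
      (f := fun ω => h (ω t).1) (C := ‖h‖) (.of_forall fun ω => norm_le_pi_norm h _)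
    simpa using this
  have hsum := Finset.sum_le_sum fun t (_ : t ∈ Finset.Ico m n) => hstep t
  rw [Finset.sum_Ico_sub (fun t => ∫ ω, h (ω t).1 ∂(pathMeasure μ π p)) hmn] at hsum
  linarith [(abs_le.1 (hbound n)).1, (abs_le.1 (hbound m)).2]

theorem pathMeasure_histOf_succ (μ : PMF S) (π : Policy S A) (p : TransKernel S A)
    (x : ℕ → S × A) (t : ℕ) :
    pathMeasure μ π p {ω | histOf ω (t + 1) = histOf x (t + 1)} =
      pathMeasure μ π p {ω | histOf ω t = histOf x t} *
        (π t (histOf x t) (x t).2 * p (x t).1 (x t).2 (x (t + 1)).1) := by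
  rw [pathMeasure_histOf, pathMeasure_histOf, Finset.prod_range_succ, mul_assoc]

/-- If all decisions on a set of histories agree, so does the conditional law of the next step. -/
theorem pathMeasure_step_of_const [Nonempty A] (μ : PMF S) (π : Policy S A) (p : TransKernel S A)
    (t : ℕ) (E : Set (ℕ → S × A)) (hE : ∀ ω ω', histOf ω t = histOf ω' t → ω ∈ E → ω' ∈ E)
    (a : A) (s' : S) (c : ENNReal) (hc : ∀ ω ∈ E, π t (histOf ω t) a * p (ω t).1 a s' = c) :
    pathMeasure μ π p {ω | ω ∈ E ∧ (ω t).2 = a ∧ (ω (t + 1)).1 = s'} =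
      pathMeasure μ π p E * c := by
  rw [measure_eq_sum_fiber _ (measurable_histOf t),
    measure_eq_sum_fiber _ (measurable_histOf t) E, Finset.sum_mul]
  refine Finset.sum_congr rfl fun h _ => ?_
  obtain ⟨y, rfl⟩ := histOf_surjective t h
  by_cases hy : y ∈ E
  · -- `x` has the history of `y` up to time `t` and then takes the prescribed step.
    let x : ℕ → S × A := fun i => if i < t then y i else if i = t then ((y t).1, a) else (s', a)
    have hxy : histOf x t = histOf y t :=
      Prod.ext (funext fun i => by simp [x, histOf]) (by simp [x, histOf])
    have hxE : x ∈ E := hE y x hxy.symm hy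
    have hxt : x t = ((y t).1, a) := by simp [x]
    have hxt' : x (t + 1) = (s', a) := by simp [x]
    have h1 : {ω | histOf ω t = histOf y t ∧ ω ∈ E} = {ω | histOf ω t = histOf x t} := by
      ext ω
      simp only [Set.mem_ofPred_eq, hxy]
      exact ⟨fun h => h.1, fun h => ⟨h, hE y ω h.symm hy⟩⟩
    have h2 : {ω | histOf ω t = histOf y t ∧
        ω ∈ {ω | ω ∈ E ∧ (ω t).2 = a ∧ (ω (t + 1)).1 = s'}} =
        {ω | histOf ω (t + 1) = histOf x (t + 1)} := by
      ext ω
      rw [Set.mem_ofPred_eq, Set.mem_ofPred_eq, Set.mem_ofPred_eq, histOf_succ_eq_iff, hxy, hxt,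
        hxt']
      exact ⟨fun h => ⟨h.1, h.2.2⟩, fun h => ⟨h.1, hE y ω h.1.symm hy, h.2⟩⟩
    have h3 := hc x hxE
    rw [h1, h2, pathMeasure_histOf_succ]
    congr 1
    rw [hxt'] at *
    rw [← h3, hxt]
  · have h1 : ∀ F : Set (ℕ → S × A), F ⊆ E → {ω | histOf ω t = histOf y t ∧ ω ∈ F} = ∅ := by
      intro F hF
      exact Set.eq_empty_iff_forall_notMem.2 fun ω hω => hy (hE ω y hω.1 (hF hω.2))
    rw [h1 _ fun ω hω => hω.1, h1 _ subset_rfl]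
    simp

/-- If from time `m` on the policy `σ` acts for `N` steps as a fresh instance of `π`, then the
history of these steps has the law of a history of `π` started from the law of `X_m`. -/
theorem pathMeasure_restart [Nonempty A] (μ : PMF S) (σ π : Policy S A) (p : TransKernel S A)
    (m N : ℕ) (hσ : ∀ n < N, ∀ ω : ℕ → S × A,
      σ (m + n) (histOf ω (m + n)) = π n (histOf (fun i => ω (m + i)) n))
    (G : Set (Hist S A N)) :
    pathMeasure μ σ p {ω | histOf (fun i => ω (m + i)) N ∈ G} =
      ∑ s, pathMeasure μ σ p {ω | (ω m).1 = s} *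
        pathMeasure (PMF.pure s) π p {ω | histOf ω N ∈ G} := by
  classical
  -- Both laws have the same product formula, apart from the weight of the initial state.
  have hpt : ∀ n ≤ N, ∀ x : ℕ → S × A,
      pathMeasure μ σ p {ω | histOf (fun i => ω (m + i)) n = histOf x n} =
        pathMeasure μ σ p {ω | (ω m).1 = (x 0).1} * ∏ i ∈ Finset.range n,
          (π i (histOf x i) (x i).2 * p (x i).1 (x i).2 (x (i + 1)).1) := by
    intro n
    induction n with
    | zero =>
      intro _ x
      simp only [Finset.range_zero, Finset.prod_empty, mul_one]
      congr 1
      ext ω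
      exact ⟨fun h => congrArg Prod.snd h, fun h => Prod.ext (funext fun i => i.elim0) h⟩
    | succ n ih =>
      intro hn x
      rw [Finset.prod_range_succ, ← mul_assoc, ← ih (by omega) x, ← pathMeasure_step_of_const μ σ p
        (m + n) {ω | histOf (fun i => ω (m + i)) n = histOf x n} ?_ (x n).2 (x (n + 1)).1 _ ?_]
      · congr 1
        ext ω
        exact histOf_succ_eq_iff (fun i => ω (m + i)) x n
      · intro ω ω' hωω' hω
        rw [Set.mem_ofPred_eq] at hω ⊢
        rw [← hω]
        refine Prod.ext (funext fun i => ?_) (congrArg Prod.snd hωω').symm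
        exact (congrFun (congrArg Prod.fst hωω') ⟨m + i, by omega⟩).symm
      · intro ω hω
        rw [Set.mem_ofPred_eq] at hω
        rw [hσ n (by omega), hω]
        have : (ω (m + n)).1 = (x n).1 := congrArg Prod.snd hω
        rw [this]
  have hshift : Measurable fun (ω : ℕ → S × A) (i : ℕ) => ω (m + i) := by fun_prop
  have hmeas : Measurable fun ω : ℕ → S × A => histOf (fun i => ω (m + i)) N :=
    (measurable_histOf N).comp hshift
  rw [measure_eq_sum_fiber _ hmeas]
  have hG : ∀ s, pathMeasure (PMF.pure s) π p {ω | histOf ω N ∈ G} = _ := fun s =>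
    measure_eq_sum_fiber _ (measurable_histOf N) _
  simp only [hG, Finset.mul_sum]
  rw [Finset.sum_comm]
  refine Finset.sum_congr rfl fun h _ => ?_
  obtain ⟨x, rfl⟩ := histOf_surjective N h
  by_cases hx : histOf x N ∈ G
  · have h1 : ∀ T : (ℕ → S × A) → Hist S A N, {ω | T ω = histOf x N ∧ ω ∈ {ω | T ω ∈ G}} =
        {ω | T ω = histOf x N} := fun T => by
      ext ω
      exact ⟨fun h => h.1, fun h => ⟨h, (show T ω ∈ G by rwa [show T ω = histOf x N from h])⟩⟩
    simp only [h1]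
    rw [hpt N le_rfl, Finset.sum_eq_single (x 0).1]
    · rw [pathMeasure_histOf, PMF.pure_apply_self, one_mul]
    · intro s _ hs
      rw [pathMeasure_histOf, PMF.pure_apply_of_ne _ _ hs.symm]
      simp
    · simp
  · have h1 : ∀ T : (ℕ → S × A) → Hist S A N,
        {ω | T ω = histOf x N ∧ ω ∈ {ω | T ω ∈ G}} = ∅ := fun T =>
      Set.eq_empty_iff_forall_notMem.2 fun ω hω => by
        obtain ⟨h2, h3⟩ := hω
        exact hx (h2 ▸ (show T ω ∈ G from h3))
    simp only [h1]
    simp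

end Paths

/-! ### Regret over doubling epochs -/

theorem doublingRestart_histOf {S A : Type*} {K : ℕ} (hK : 1 ≤ K) (π₀ : Policy S A)
    (π : ℕ → Policy S A) (n j : ℕ) (hj : j < 2 ^ n * K) (ω : ℕ → S × A) :
    doublingRestart K π₀ π (2 ^ n * K + j) (histOf ω (2 ^ n * K + j)) =
      π (2 ^ n * K) j (histOf (fun i => ω (2 ^ n * K + i)) j) := by
  rw [doublingRestart_apply K n _ hK π₀ π (by omega) (by rw [pow_succ, mul_right_comm]; omega)]
  generalize 2 ^ n * K = L
  -- The index `L + j - L` is not definitionally `j`, and `π L` depends on it through its type.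
  have h : ∀ k, k = j → π L k (fun i => ω (L + i), (ω (L + j)).1) =
      π L j (histOf (fun i => ω (L + i)) j) := by
    rintro k rfl
    rfl
  exact h _ (Nat.add_sub_cancel_left ..)

/-- Sums over doubling epochs that are small relative to the epochs make the averages small. Inside
an epoch, the lower bound on all partial sums controls what remains of the epoch. -/
theorem tendsto_average_of_doubling {e d : ℕ → ℝ} {K : ℕ} (hK : 1 ≤ K) {C : ℝ}
    (hd : Tendsto d atTop (𝓝 0)) (he : ∀ t, e t ≤ 1)
    (hlow : ∀ m n, m ≤ n → -C ≤ ∑ t ∈ Finset.Ico m n, e t)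
    (hep : ∀ n, ∑ t ∈ Finset.Ico (2 ^ n * K) (2 ^ n * K + 2 ^ n * K), e t ≤
      K * (2 ^ n * d n)) :
    Tendsto (fun T : ℕ => 1 / (T : ℝ) * ∑ t ∈ Finset.range T, e t) atTop (𝓝 0) := by
  let D : ℕ → ℝ := fun N => ∑ n ∈ Finset.range N, 2 ^ n * d n
  have hDlim : Tendsto (fun N => D N / 2 ^ N) atTop (𝓝 0) := by
    have h1 : (fun n => (2 : ℝ) ^ n * d n) =o[atTop] fun n => (2 : ℝ) ^ n := by
      simpa using (Asymptotics.isBigO_refl (fun n => (2 : ℝ) ^ n) atTop).mul_isLittleO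
        ((Asymptotics.isLittleO_one_iff ℝ).2 hd)
    have h2 : Tendsto (fun N => ∑ n ∈ Finset.range N, (2 : ℝ) ^ n) atTop atTop := by
      refine tendsto_atTop_mono (fun N => ?_) tendsto_natCast_atTop_atTop
      calc (N : ℝ) = ∑ n ∈ Finset.range N, (1 : ℝ) := by simp
        _ ≤ _ := Finset.sum_le_sum fun n _ => one_le_pow₀ (by norm_num)
    refine ((h1.sum_range (fun n => by positivity) h2).trans_le fun N => ?_).tendsto_div_nhds_zero
    rw [geom_sum_eq (by norm_num), Real.norm_of_nonneg, Real.norm_of_nonneg (by positivity)]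
    · norm_num
    · have : (1 : ℝ) ≤ 2 ^ N := one_le_pow₀ (by norm_num)
      norm_num
      exact this
  -- The times before `K` contribute at most `K`, and the epochs before time `2 ^ N * K` at most
  -- `K * D N`.
  have hsum : ∀ N, ∑ t ∈ Finset.range (2 ^ N * K), e t ≤ K + K * D N := by
    intro N
    induction N with
    | zero =>
      simpa [D] using Finset.sum_le_sum fun t (_ : t ∈ Finset.range K) => he t
    | succ N ih =>
      have h1 : 2 ^ (N + 1) * K = 2 ^ N * K + 2 ^ N * K := by ring
      rw [h1, ← Finset.sum_range_add_sum_Ico e (Nat.le_add_right (2 ^ N * K) (2 ^ N * K))]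
      have h2 : D (N + 1) = D N + 2 ^ N * d N := Finset.sum_range_succ ..
      rw [h2, mul_add]
      linarith [hep N]
  have hlog : Tendsto (fun T => Nat.log 2 T + 1) atTop atTop := by
    refine tendsto_atTop_atTop.2 fun b => ⟨2 ^ b, fun T hT => ?_⟩
    have := Nat.le_log_of_pow_le one_lt_two hT
    omega
  have hinv : Tendsto (fun T : ℕ => 1 / (T : ℝ)) atTop (𝓝 0) := tendsto_one_div_atTop_nhds_zero_nat
  have hupper : Tendsto (fun T : ℕ => 1 / (T : ℝ) * (K + C) +
      2 * K * |D (Nat.log 2 T + 1) / 2 ^ (Nat.log 2 T + 1)|) atTop (𝓝 0) := by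
    simpa using (hinv.mul_const (K + C)).add ((hDlim.comp hlog).abs.const_mul (2 * (K : ℝ)))
  have hlower : Tendsto (fun T : ℕ => 1 / (T : ℝ) * -C) atTop (𝓝 0) := by
    simpa using hinv.mul_const (-C)
  refine tendsto_of_tendsto_of_tendsto_of_le_of_le' hlower hupper (.of_forall fun T => ?_)
    ((eventually_ge_atTop 1).mono fun T hT => ?_)
  · have := hlow 0 T (Nat.zero_le T)
    rw [← Finset.range_eq_Ico] at this
    exact mul_le_mul_of_nonneg_left this (by positivity)
  · have hN1 : T < 2 ^ (Nat.log 2 T + 1) := Nat.lt_pow_succ_log_self one_lt_two T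
    have hN2 : 2 ^ (Nat.log 2 T + 1) ≤ 2 * T := by
      rw [pow_succ, mul_comm]
      exact Nat.mul_le_mul_left 2 (Nat.pow_log_le_self 2 (by omega))
    -- With `T < 2 ^ N ≤ 2 * T`, the horizon `T` is extended to the end `2 ^ N * K` of an epoch.
    generalize Nat.log 2 T + 1 = N at hN1 hN2
    have hTN : T ≤ 2 ^ N * K := hN1.le.trans (Nat.le_mul_of_pos_right _ hK)
    have h1 := Finset.sum_range_add_sum_Ico e hTN
    have h2 := hlow T _ hTN
    have h3 : ∑ t ∈ Finset.range T, e t ≤ (K + C) + K * D N := by linarith [hsum N]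
    have hT0 : (0 : ℝ) < T := by exact_mod_cast hT
    have h4 : 1 / (T : ℝ) * (K * D N) ≤ 2 * K * |D N / 2 ^ N| := by
      have hN2' : (2 : ℝ) ^ N ≤ 2 * T := by exact_mod_cast hN2
      have h5 : |D N| = |D N / 2 ^ N| * 2 ^ N := by
        rw [abs_div, abs_of_pos (by positivity : (0 : ℝ) < 2 ^ N), div_mul_cancel₀]
        positivity
      rw [one_div, inv_mul_le_iff₀ hT0]
      calc (K : ℝ) * D N ≤ K * (|D N / 2 ^ N| * (2 * T)) := by
            gcongr
            exact (le_abs_self _).trans (h5.le.trans (by gcongr))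
        _ = _ := by ring
    calc _ ≤ 1 / (T : ℝ) * ((K + C) + K * D N) := by gcongr
      _ ≤ _ := by rw [mul_add]; gcongr

section Epochs

variable {S A : Type*} [Fintype S] [Fintype A] [MeasurableSpace S] [MeasurableSpace A]
  [DiscreteMeasurableSpace S] [DiscreteMeasurableSpace A]

/-- A high-probability bound on the regret of `π` over `N` steps, uniform in the initial state,
bounds the expected regret over `N` steps of a policy that restarts `π` at time `m`. -/
theorem sum_integral_restart_le [Nonempty A] {p : TransKernel S A} {r : Reward S A} {g c ε : ℝ}
    (hg : g ≤ 1) (hc : 0 ≤ c) (μ : PMF S) {σ π : Policy S A} {m N : ℕ}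
    (hσ : ∀ n < N, ∀ ω : ℕ → S × A,
      σ (m + n) (histOf ω (m + n)) = π n (histOf (fun i => ω (m + i)) n))
    (hreg : ∀ s, 1 - ε ≤ (pathMeasure (PMF.pure s) π p).real
      {ω | ∑ i ∈ Finset.range N, (g - (r (ω i).1 (ω i).2 : ℝ)) ≤ c}) :
    ∑ t ∈ Finset.Ico m (m + N), ∫ ω, (g - (r (ω t).1 (ω t).2 : ℝ)) ∂(pathMeasure μ σ p) ≤
      c + N * ε := by
  set P := pathMeasure μ σ p
  let ρ : Hist S A N → ℝ := fun h => ∑ i, (g - (r (h.1 i).1 (h.1 i).2 : ℝ))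
  have hρ : ∀ ω : ℕ → S × A,
      ρ (histOf ω N) = ∑ i ∈ Finset.range N, (g - (r (ω i).1 (ω i).2 : ℝ)) := fun ω => by
    rw [Finset.sum_range]
    rfl
  have hρN : ∀ h, ρ h ≤ N := fun h => by
    calc ρ h ≤ ∑ _i : Fin N, (1 : ℝ) := Finset.sum_le_sum fun i _ => by
          have := (r (h.1 i).1 (h.1 i).2).2.1
          linarith
      _ = N := by simp
  let G : Set (Hist S A N) := {h | c < ρ h}
  have hshift : Measurable fun (ω : ℕ → S × A) (i : ℕ) => ω (m + i) := by fun_prop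
  have hmeas : Measurable fun ω : ℕ → S × A => histOf (fun i => ω (m + i)) N :=
    (measurable_histOf N).comp hshift
  let E : Set (ℕ → S × A) := {ω | histOf (fun i => ω (m + i)) N ∈ G}
  have hE : MeasurableSet E := hmeas .of_discrete
  have hprob : P.real E ≤ ε := by
    have hs : ∀ s, (pathMeasure (PMF.pure s) π p).real {ω | histOf ω N ∈ G} ≤ ε := by
      intro s
      have e : {ω : ℕ → S × A | histOf ω N ∈ G} =
          {ω | ∑ i ∈ Finset.range N, (g - (r (ω i).1 (ω i).2 : ℝ)) ≤ c}ᶜ := by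
        ext ω
        rw [Set.mem_compl_iff, Set.mem_ofPred_eq, Set.mem_ofPred_eq, Set.mem_ofPred_eq, ← hρ,
          not_le]
      have hm : MeasurableSet {ω : ℕ → S × A |
          ∑ i ∈ Finset.range N, (g - (r (ω i).1 (ω i).2 : ℝ)) ≤ c} := by
        have : MeasurableSet {ω : ℕ → S × A | histOf ω N ∈ G} :=
          measurable_histOf N .of_discrete
        rw [e] at this
        exact this.of_compl
      rw [e, probReal_compl_eq_one_sub hm]
      linarith [hreg s]
    have hsum : ∑ s, P.real {ω | (ω m).1 = s} = 1 := by
      have h := measure_eq_sum_fiber P (X := fun ω : ℕ → S × A => (ω m).1) (by fun_prop) Set.univ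
      simp only [Set.mem_univ, and_true, measure_univ] at h
      simp only [Measure.real]
      rw [← ENNReal.toReal_sum fun _ _ => measure_ne_top _ _, ← h, ENNReal.toReal_one]
    rw [Measure.real, pathMeasure_restart μ σ π p m N hσ G, ENNReal.toReal_sum
      fun _ _ => ENNReal.mul_ne_top (measure_ne_top _ _) (measure_ne_top _ _)]
    calc _ ≤ ∑ s, P.real {ω | (ω m).1 = s} * ε := Finset.sum_le_sum fun s _ => by
          rw [ENNReal.toReal_mul]
          exact mul_le_mul_of_nonneg_left (hs s) ENNReal.toReal_nonneg
      _ = ε := by rw [← Finset.sum_mul, hsum, one_mul]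
  have hint : ∀ t, Integrable (fun ω : ℕ → S × A => g - (r (ω t).1 (ω t).2 : ℝ)) P := fun t =>
    integrable_comp_of_finite P (X := fun ω : ℕ → S × A => ω t) (by fun_prop)
      fun y => g - (r y.1 y.2 : ℝ)
  rw [← integral_finsetSum _ fun t _ => hint t]
  -- On the exceptional event the regret is at most `N`, because `g ≤ 1` and `r ≥ 0`.
  have hle : ∀ ω : ℕ → S × A, ∑ t ∈ Finset.Ico m (m + N), (g - (r (ω t).1 (ω t).2 : ℝ)) ≤
      c + N * E.indicator 1 ω := by
    intro ω
    rw [Finset.sum_Ico_eq_sum_range, Nat.add_sub_cancel_left, ← hρ fun i => ω (m + i)]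
    by_cases h : histOf (fun i => ω (m + i)) N ∈ G
    · rw [Set.indicator_of_mem (show ω ∈ E from h)]
      simpa using (hρN _).trans (le_add_of_nonneg_left hc)
    · rw [Set.indicator_of_notMem (show ω ∉ E from h), mul_zero, add_zero]
      exact not_lt.1 h
  have hind : Integrable (E.indicator
      (1 : (ℕ → S × A) → ℝ)) P := (integrable_const 1).indicator hE
  refine (integral_mono (integrable_finsetSum _ fun t _ => hint t)
    ((integrable_const c).add (hind.const_mul _)) hle).trans ?_
  simp only [Pi.add_apply]
  rw [integral_add (integrable_const c) (hind.const_mul _), integral_const_mul,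
    integral_indicator_one hE]
  simp only [integral_const, probReal_univ, one_smul]
  gcongr

end Epochs

/-! ### Point masses among the admissible decisions -/

section Univ

variable {S A : Type*} [Fintype S]

/-- If an action earns the largest reward `1` in every state, the optimal gain is at least `1`.
Where `α` is smallest, it is preserved by every action; and at a point of this set where `v` is
smallest, the second optimality equation gives `α ≥ 1`. -/
theorem one_le_optGain (p : TransKernel S A) {r : Reward S A} {a : A} (ha : ∀ s, r s a = 1)
    (s : S) : 1 ≤ optGain p r s := by
  have hr : ∀ x, (r x a : ℝ) = 1 := fun x => by simp [ha x]
  refine le_csInf ⟨1, fun _ => 1, fun _ => 0, ⟨fun x => ?_, fun x => ?_⟩, rfl⟩ ?_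
  · have e : ∀ b : A, ∑ s', (p x b s').toReal * (1 : ℝ) = 1 := fun b => nextMean_const p 1 x b
    have : Nonempty A := ⟨a⟩
    simp only [e]
    rw [Set.range_const]
    exact isGreatest_singleton
  · refine ⟨⟨a, by simp [ha x]⟩, ?_⟩
    rintro _ ⟨b, rfl⟩
    simpa using (r x b).2.2
  · rintro _ ⟨α, v, ⟨hα, hv⟩, rfl⟩
    have : Nonempty S := ⟨s⟩
    obtain ⟨m, hm⟩ := Finite.exists_min α
    obtain ⟨x, hx, hmin⟩ := Set.exists_min_image {y | α y = α m} v (Set.toFinite _) ⟨m, rfl⟩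
    have hx' : α x = α m := hx
    have h1 : ∑ s', (p x a s').toReal * (v s' - v x) ≥ 0 := by
      refine Finset.sum_nonneg fun s' _ => ?_
      rcases (ENNReal.toReal_nonneg (a := p x a s')).eq_or_lt with h0 | h0
      · rw [← h0, zero_mul]
      · refine mul_nonneg h0.le (sub_nonneg.2 (hmin s' ?_))
        exact eq_of_nextMean_le hm (hx' ▸ (hα x).2 ⟨a, rfl⟩) h0
    have h2 := (hv x).2 ⟨a, rfl⟩
    dsimp only at h2
    simp only [mul_sub, Finset.sum_sub_distrib] at h1
    rw [← Finset.sum_mul, PMF.sum_toReal, one_mul] at h1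
    linarith [hm s, hr x]

variable [Fintype A] [MeasurableSpace S] [MeasurableSpace A]
  [DiscreteMeasurableSpace S] [DiscreteMeasurableSpace A]

theorem measurable_regret (p : TransKernel S A) (r : Reward S A) (T : ℕ) :
    Measurable fun ω : ℕ → S × A => regret p r T ω := by
  refine Finset.measurable_sum _ fun t _ => ?_
  have h1 : Measurable fun ω : ℕ → S × A => optGain p r (ω 0).1 :=
    (Measurable.of_discrete (f := fun y : S × A => optGain p r y.1)).comp (measurable_pi_apply 0)
  have h2 : Measurable fun ω : ℕ → S × A => (r (ω t).1 (ω t).2 : ℝ) :=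
    (Measurable.of_discrete (f := fun y : S × A => (r y.1 y.2 : ℝ))).comp (measurable_pi_apply t)
  exact h1.sub h2

/-- Policies do not observe the rewards, so if they have small regret for all reward functions,
there is only one action: the rewards `1_a` and `1_b` of two actions both have optimal gain at
least `1`, but their total along any path is at most `1` per step. -/
theorem subsingleton_of_regret_le {p : TransKernel S A} {μ : PMF S} {π : ℕ → Policy S A}
    {η β : ℝ} {K : ℕ} (hη : η < 1) (hβ : 0 < β)
    (hreg : ∀ r : Reward S A, ∃ f : ℝ, 0 ≤ f ∧ ∀ T : ℕ, K ≤ T →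
      1 - 1 / (T : ℝ) ^ β ≤
        (pathMeasure μ (π T) p).real {ω | regret p r T ω ≤ f * (T : ℝ) ^ η}) :
    Subsingleton A := by
  classical
  refine ⟨fun a b => ?_⟩
  by_contra hab
  let ind : A → Reward S A := fun c _ x => if x = c then 1 else 0
  obtain ⟨f₁, -, h₁⟩ := hreg (ind a)
  obtain ⟨f₂, -, h₂⟩ := hreg (ind b)
  have hlim1 : Tendsto (fun T : ℕ => 1 / (T : ℝ) ^ β) atTop (𝓝 0) :=
    ((tendsto_rpow_atTop hβ).comp tendsto_natCast_atTop_atTop).const_div_atTop 1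
  have hlim2 : Tendsto (fun T : ℕ => (f₁ + f₂) * (T : ℝ) ^ (-(1 - η))) atTop (𝓝 0) := by
    simpa using ((tendsto_rpow_neg_atTop (by linarith : 0 < 1 - η)).comp
      tendsto_natCast_atTop_atTop).const_mul (f₁ + f₂)
  obtain ⟨T, hT1, hT2, hTK, hT0⟩ := ((hlim1.eventually_lt_const (by norm_num : (0 : ℝ) < 1 / 2)).and
    ((hlim2.eventually_lt_const one_pos).and
      ((eventually_ge_atTop K).and (eventually_ge_atTop 1)))).exists
  have hTpos : (0 : ℝ) < T := by exact_mod_cast hT0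
  obtain ⟨ω, hω₁, hω₂⟩ : ({ω | regret p (ind a) T ω ≤ f₁ * (T : ℝ) ^ η} ∩
      {ω | regret p (ind b) T ω ≤ f₂ * (T : ℝ) ^ η}).Nonempty := by
    by_contra hemp
    have hdisj := Set.disjoint_iff_inter_eq_empty.2 (Set.not_nonempty_iff_eq_empty.1 hemp)
    have hu := measureReal_union (μ := pathMeasure μ (π T) p) hdisj
      (measurableSet_le (measurable_regret p (ind b) T) measurable_const)
    have hle := measureReal_le_one (μ := pathMeasure μ (π T) p)
      (s := {ω | regret p (ind a) T ω ≤ f₁ * (T : ℝ) ^ η} ∪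
        {ω | regret p (ind b) T ω ≤ f₂ * (T : ℝ) ^ η})
    linarith [h₁ T hTK, h₂ T hTK]
  have hsum : (T : ℝ) ≤ regret p (ind a) T ω + regret p (ind b) T ω := by
    rw [regret, regret, ← Finset.sum_add_distrib]
    calc (T : ℝ) = ∑ t ∈ Finset.range T, (1 : ℝ) := by simp
      _ ≤ _ := Finset.sum_le_sum fun t _ => by
        have g1 := one_le_optGain p (r := ind a) (a := a) (by simp [ind]) (ω 0).1
        have g2 := one_le_optGain p (r := ind b) (a := b) (by simp [ind]) (ω 0).1
        have h3 : (ind a (ω t).1 (ω t).2 : ℝ) + (ind b (ω t).1 (ω t).2 : ℝ) ≤ 1 := by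
          by_cases e : (ω t).2 = a
          · simp [ind, e, hab]
          · by_cases e' : (ω t).2 = b <;> simp [ind, e, e', Ne.symm hab]
        linarith
  have hω₁' : regret p (ind a) T ω ≤ f₁ * (T : ℝ) ^ η := hω₁
  have hω₂' : regret p (ind b) T ω ≤ f₂ * (T : ℝ) ^ η := hω₂
  have hpow : (T : ℝ) ^ η = T * (T : ℝ) ^ (-(1 - η)) := by
    rw [neg_sub, Real.rpow_sub_one hTpos.ne', mul_div_cancel₀ _ hTpos.ne']
  have : (f₁ + f₂) * (T : ℝ) ^ η < T := by
    rw [hpow, mul_left_comm]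
    exact mul_lt_of_lt_one_right hTpos hT2
  linarith

end Univ

/-! ### Sublinear regret of the doubling-epoch restart policy -/

theorem doublingRestart_mem_PiH {S A : Type*} {Q : Set (PMF A)} (K : ℕ) {π₀ : Policy S A}
    {π : ℕ → Policy S A} (hπ₀ : π₀ ∈ PiH Q) (hπ : ∀ T, π T ∈ PiH Q) :
    doublingRestart K π₀ π ∈ PiH Q := by
  intro t h
  unfold doublingRestart
  split_ifs
  · exact hπ₀ t h
  · exact hπ _ _ _

theorem proposition2 {S A : Type*} [Fintype S] [Fintype A]
    [MeasurableSpace S] [MeasurableSpace A]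
    [DiscreteMeasurableSpace S] [DiscreteMeasurableSpace A]
    (Q : Set (PMF A)) (P : Set (TransKernel S A)) (R : Set (Reward S A))
    (hQ : R ≠ Set.univ → ∀ a : A, PMF.pure a ∈ Q)
    (hP : ∀ p ∈ P, IsWeaklyCommunicating Q p)
    (π : ℕ → Policy S A) (hπ : ∀ T, π T ∈ PiH Q)
    (η β : ℝ) (K : ℕ) (hη : 0 < η) (hη' : η < 1) (hβ : 0 < β) (hK : 1 ≤ K)
    (hreg : ∀ p ∈ P, ∀ r ∈ R, ∀ μ : PMF S, ∃ f : ℝ, 0 ≤ f ∧ ∀ T : ℕ, K ≤ T →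
      1 - 1 / (T : ℝ) ^ β ≤
        (pathMeasure μ (π T) p).real {ω | regret p r T ω ≤ f * (T : ℝ) ^ η}) :
    (PiRL Q P R).Nonempty ∧
      ∀ π₀ ∈ PiH Q, doublingRestart K π₀ π ∈ PiRL Q P R := by
  suffices h : ∀ π₀ ∈ PiH Q, doublingRestart K π₀ π ∈ PiRL Q P R from ⟨⟨_, h (π 0) (hπ 0)⟩, h⟩
  intro π₀ hπ₀
  refine ⟨doublingRestart_mem_PiH K hπ₀ hπ, fun p hp μ r hr => Tendsto.limsup_eq ?_⟩
  obtain ⟨s₀, -⟩ := μ.support_nonempty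
  obtain ⟨a₀, -⟩ := (π 0 0 (Fin.elim0, s₀)).support_nonempty
  have : Nonempty A := ⟨a₀⟩
  have hpure : ∀ a : A, PMF.pure a ∈ Q := by
    -- For the class of all rewards there is only one action, and its point mass is a value of
    -- `π 0`.
    by_cases hR : R = Set.univ
    · have hsub := subsingleton_of_regret_le hη' hβ
        fun r => hreg p hp r (hR ▸ Set.mem_univ r) μ
      intro a
      have e : π 0 0 (Fin.elim0, s₀) = PMF.pure a := by
        ext b
        have h1 := (π 0 0 (Fin.elim0, s₀)).tsum_coe
        obtain rfl : b = a := Subsingleton.elim _ _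
        rw [tsum_eq_single b fun c hc => (hc (Subsingleton.elim c b)).elim] at h1
        rw [h1, PMF.pure_apply_self]
      exact e ▸ hπ 0 0 _
    · exact hQ hR
  obtain ⟨g, h, hg1, hgain, hbell⟩ := (hP p hp).exists_optGain_eq hpure r
  -- The constants of the initial laws `δ_s` bound the regret from any initial law, in particular
  -- from the law of the state at the start of an epoch, which varies with the epoch.
  choose f hf hfreg using fun s => hreg p hp r hr (PMF.pure s)
  have hregret : ∀ T (ω : ℕ → S × A), regret p r T ω =
      ∑ t ∈ Finset.range T, (g - (r (ω t).1 (ω t).2 : ℝ)) := fun T ω => by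
    simp only [regret, hgain]
  set σ := doublingRestart K π₀ π
  have hint : ∀ t, Integrable (fun ω : ℕ → S × A => g - (r (ω t).1 (ω t).2 : ℝ))
      (pathMeasure μ σ p) := fun t =>
    integrable_comp_of_finite _ (X := fun ω : ℕ → S × A => ω t) (by fun_prop)
      fun y => g - (r y.1 y.2 : ℝ)
  simp only [hregret]
  simp only [integral_finsetSum _ fun t _ => hint t]
  have hL : Tendsto (fun n => ((2 ^ n * K : ℕ) : ℝ)) atTop atTop := by
    refine tendsto_natCast_atTop_atTop.comp (tendsto_atTop_mono (fun n => ?_) tendsto_id)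
    exact n.lt_two_pow_self.le.trans (Nat.le_mul_of_pos_right _ hK)
  have hd : Tendsto (fun n => (∑ s, f s) * ((2 ^ n * K : ℕ) : ℝ) ^ (-(1 - η)) +
      ((2 ^ n * K : ℕ) : ℝ) ^ (-β)) atTop (𝓝 0) := by
    simpa using (((tendsto_rpow_neg_atTop (by linarith : 0 < 1 - η)).comp hL).const_mul
      (∑ s, f s)).add ((tendsto_rpow_neg_atTop hβ).comp hL)
  refine tendsto_average_of_doubling hK (C := 2 * ‖h‖) hd (fun t => ?_)
    (fun m n hmn => neg_norm_le_sum_integral hbell μ σ hmn) fun n => ?_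
  · calc _ ≤ ∫ _ω, (1 : ℝ) ∂(pathMeasure μ σ p) :=
          integral_mono (hint t) (integrable_const _) fun ω => by
            have := (r (ω t).1 (ω t).2).2.1
            dsimp only
            linarith
      _ = 1 := by simp
  · have hKL : K ≤ 2 ^ n * K := Nat.le_mul_of_pos_left _ (Nat.two_pow_pos n)
    have hcast : (K : ℝ) * 2 ^ n = ((2 ^ n * K : ℕ) : ℝ) := by push_cast; ring
    rw [← mul_assoc, hcast]
    have hσ := doublingRestart_histOf hK π₀ π n
    have hmain := sum_integral_restart_le (p := p) (r := r) (g := g)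
      (c := (∑ s, f s) * ((2 ^ n * K : ℕ) : ℝ) ^ η)
      (ε := 1 / ((2 ^ n * K : ℕ) : ℝ) ^ β) hg1
      (mul_nonneg (Finset.sum_nonneg fun s _ => hf s) (by positivity)) μ (σ := σ) hσ fun s => by
        refine (hfreg s _ hKL).trans (measureReal_mono fun ω hω => ?_)
        rw [Set.mem_ofPred_eq, hregret] at hω
        refine hω.trans (mul_le_mul_of_nonneg_right ?_ (by positivity))
        exact Finset.single_le_sum (fun s _ => hf s) (Finset.mem_univ s)
    refine hmain.trans (le_of_eq ?_)
    have hpos : (0 : ℝ) < ((2 ^ n * K : ℕ) : ℝ) := by exact_mod_cast hK.trans hKL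
    generalize ((2 ^ n * K : ℕ) : ℝ) = L at hpos
    rw [Real.rpow_neg hpos.le β, neg_sub, Real.rpow_sub_one hpos.ne', one_div, mul_add]
    field_simp
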